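/- Throughout, Hilbert spaces are complex, and operators are identified with their graphs. A linear relation $S$ in a Hilbert space $\mathcal H$ is a linear subspace of $\mathcal H\times\mathcal H$, with adjoint $S^*=\{(g,g') : (f',g)=(f,g') \text{ for all } (f,f')\in S\}$; $S$ is symmetric if $S\subset S^*$ and self-adjoint if $S=S^*$; $(S-\lambda)^{-1}=\{(f'-\lambda f,f):(f,f')\in S\}$, and $\rho(S)$ is the set of $\lambda\in\mathbb C$ for which $(S-\lambda)^{-1}$ is an everywhere defined bounded operator. A class of operator ideals $\mathfrak A$ assigns to every pair of separable Hilbert spaces $\mathcal H,\mathcal K$ a set $\mathfrak A(\mathcal H,\mathcal K)$ of compact operators from $\mathcal H$ to $\mathcal K$ which contains all operators $x\mapsto (x,u)v$ with $u\in\mathcal H$, $v\in\mathcal K$, is closed under addition, and satisfies $CAB\in\mathfrak A(\mathcal H_1,\mathcal K_1)$ for $A\in\mathfrak A(\mathcal H,\mathcal K)$ and bounded $B:\mathcal H_1\to\mathcal H$, $C:\mathcal K\to\mathcal K_1$. Write $\mathfrak A(\mathcal H)=\mathfrak A(\mathcal H,\mathcal H)$, $\mathfrak A^*(\mathcal H,\mathcal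 K)=\{A^* : A\in\mathfrak A(\mathcal K,\mathcal H)\}$, and let $(\mathfrak A\cdot\mathfrak B)(\mathcal H,\mathcal K)$ be the set of all products $AB$ with $A\in\mathfrak A(\mathcal L,\mathcal K)$, $B\in\mathfrak B(\mathcal H,\mathcal L)$ for some separable Hilbert space $\mathcal L$. Let $A$ be a closed symmetric relation in a separable Hilbert space $\mathcal H$ and let $\{\mathcal G,\Gamma_0,\Gamma_1\}$ be a quasi boundary triple for $A^*$: $\mathcal G$ is a Hilbert space, $\Gamma_0,\Gamma_1:T\to\mathcal G$ are linear maps on a dense subspace $T$ of $A^*$, $\{(\Gamma_0\hat f,\Gamma_1\hat f):\hat f\in T\}$ is dense in $\mathcal G\times\mathcal G$, $A_0:=\ker\Gamma_0$ is self-adjoint, and $(f',g)-(f,g')=(\Gamma_1\hat f,\Gamma_0\hat g)-(\Gamma_0\hat f,\Gamma_1\hat g)$ for all $\hat f=(f,f')$, $\hat g=(g,g')$ in $T$. (Then $\mathcal G$ is separable as well.) For $\lambda\in\rho(A_0)$ let $\gamma(\lambda)$ and $M(\lambda)$ be the operators defined on $\operatorname{ran}\Gamma_0$ by $\gamma(\lambda)\Gamma_0\hat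 f=f$ and $M(\lambda)\Gamma_0\hat f=\Gamma_1\hat f$ for $\hat f=(f,\lambda f)\in T$. For an operator $\Theta$ in $\mathcal G$ let $A_\Theta=\{\hat f\in T : \Gamma_1\hat f=\Theta\Gamma_0\hat f\}$. Let $\mathfrak B$ be a class of operator ideals, let $\Theta_1,\Theta_2$ be bounded self-adjoint operators in $\mathcal G$, and assume: (i) the closure $\overline{M(\lambda_0)}$ is an everywhere defined compact operator in $\mathcal G$ for some $\lambda_0\in\rho(A_0)$; (ii) $0\notin\sigma_{\rm ess}(\Theta_i)$ (that is, $\Theta_i$ is a Fredholm operator) and $A_{\Theta_i}=A_{\Theta_i}^*$ for $i=1,2$; (iii) $\Theta_1-\Theta_2\in\mathfrak B(\mathcal G)$. Then $$(A_{\Theta_1}-\lambda)^{-1}-(A_{\Theta_2}-\lambda)^{-1}\in\mathfrak B(\mathcal H)\qquad\text{for all }\lambda\in\rho(A_{\Theta_1})\cap\rho(A_{\Theta_2}).$$ If, in addition, $\mathfrak A$ is another class of operator ideals and $\gamma(\lambda_1)^*\in\mathfrak A^*(\mathcal H,\mathcal G)$ for some $\lambda_1\in\rho(A_0)$, then $$(A_{\Theta_1}-\lambda)^{-1}-(A_{\Theta_2}-\lambda)^{-1}\in(\mathfrak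 A\cdot\mathfrak B\cdot\mathfrak A^*)(\mathcal H)\qquad\text{for all }\lambda\in\rho(A_{\Theta_1})\cap\rho(A_{\Theta_2}).$$ -/

import Mathlib

universe u

noncomputable section

/-! ### Linear relations

A linear relation from `E` to `F` is a linear subspace of `E × F`; an operator is identified with
its graph. The adjoint relation is Mathlib's `Submodule.adjoint`. -/

namespace LinRel

variable {H : Type u} [NormedAddCommGroup H] [InnerProductSpace ℂ H]

/-- `S ⊆ S*`. -/
def IsSymmetric (S : Submodule ℂ (H × H)) : Prop := S ≤ S.adjoint

/-- `S = S*`. -/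
def IsSelfAdjoint (S : Submodule ℂ (H × H)) : Prop := S = S.adjoint

/-- The relation `(S - z)⁻¹ = {(f' - z f, f) : (f, f') ∈ S}`. -/
def subInv (S : Submodule ℂ (H × H)) (z : ℂ) : Submodule ℂ (H × H) :=
  S.map ((LinearMap.snd ℂ H H - z • LinearMap.fst ℂ H H).prod (LinearMap.fst ℂ H H))

/-- The resolvent set: all `z` such that `(S - z)⁻¹` is (the graph of) an everywhere defined
bounded operator. -/
def resolventSet (S : Submodule ℂ (H × H)) : Set ℂ :=
  {z | ∃ R : H →L[ℂ] H, subInv S z = R.toLinearMap.graph}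

open Classical in
/-- The bounded operator `(S - z)⁻¹` for `z ∈ resolventSet S` (and `0` otherwise). -/
def resolvent (S : Submodule ℂ (H × H)) (z : ℂ) : H →L[ℂ] H :=
  if h : z ∈ resolventSet S then h.choose else 0

theorem subInv_eq_graph_resolvent {S : Submodule ℂ (H × H)} {z : ℂ} (h : z ∈ resolventSet S) :
    subInv S z = (resolvent S z).toLinearMap.graph := by
  rw [resolvent, dif_pos h]
  exact h.choose_spec

end LinRel

/-- The essential spectrum of a bounded operator: all `z` such that `Θ - z` is not Fredholm. -/
def essentialSpectrum {G : Type u} [NormedAddCommGroup G] [InnerProductSpace ℂ G]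
    (Θ : G →L[ℂ] G) : Set ℂ :=
  {z | ¬ (Θ - z • ContinuousLinearMap.id ℂ G).IsFredholm}

/-! ### Classes of operator ideals -/

/-- A choice of a set of bounded operators `𝔄(H, K)` for every pair of separable complex Hilbert
spaces `H`, `K`. -/
def OperatorFamily : Type (u + 1) :=
  ∀ (H K : Type u) [NormedAddCommGroup H] [InnerProductSpace ℂ H] [CompleteSpace H]
    [TopologicalSpace.SeparableSpace H] [NormedAddCommGroup K] [InnerProductSpace ℂ K]
    [CompleteSpace K] [TopologicalSpace.SeparableSpace K], Set (H →L[ℂ] K)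

/-- `𝔄` is a class of operator ideals. -/
structure IsOperatorIdealClass (𝔄 : OperatorFamily.{u}) : Prop where
  isCompactOperator : ∀ {H K : Type u} [NormedAddCommGroup H] [InnerProductSpace ℂ H]
    [CompleteSpace H] [TopologicalSpace.SeparableSpace H] [NormedAddCommGroup K]
    [InnerProductSpace ℂ K] [CompleteSpace K] [TopologicalSpace.SeparableSpace K]
    {A : H →L[ℂ] K}, A ∈ 𝔄 H K → IsCompactOperator A
  /-- `InnerProductSpace.rankOne ℂ v w` is the operator `x ↦ (x, w) v`. -/
  rankOne_mem : ∀ {H K : Type u} [NormedAddCommGroup H] [InnerProductSpace ℂ H]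
    [CompleteSpace H] [TopologicalSpace.SeparableSpace H] [NormedAddCommGroup K]
    [InnerProductSpace ℂ K] [CompleteSpace K] [TopologicalSpace.SeparableSpace K]
    (w : H) (v : K), InnerProductSpace.rankOne ℂ v w ∈ 𝔄 H K
  add_mem : ∀ {H K : Type u} [NormedAddCommGroup H] [InnerProductSpace ℂ H]
    [CompleteSpace H] [TopologicalSpace.SeparableSpace H] [NormedAddCommGroup K]
    [InnerProductSpace ℂ K] [CompleteSpace K] [TopologicalSpace.SeparableSpace K]
    {A B : H →L[ℂ] K}, A ∈ 𝔄 H K → B ∈ 𝔄 H K → A + B ∈ 𝔄 H K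
  comp_mem : ∀ {H K H₁ K₁ : Type u} [NormedAddCommGroup H] [InnerProductSpace ℂ H]
    [CompleteSpace H] [TopologicalSpace.SeparableSpace H] [NormedAddCommGroup K]
    [InnerProductSpace ℂ K] [CompleteSpace K] [TopologicalSpace.SeparableSpace K]
    [NormedAddCommGroup H₁] [InnerProductSpace ℂ H₁]
    [CompleteSpace H₁] [TopologicalSpace.SeparableSpace H₁] [NormedAddCommGroup K₁]
    [InnerProductSpace ℂ K₁] [CompleteSpace K₁] [TopologicalSpace.SeparableSpace K₁]
    {A : H →L[ℂ] K} (B : H₁ →L[ℂ] H) (C : K →L[ℂ] K₁), A ∈ 𝔄 H K → C ∘L A ∘L B ∈ 𝔄 H₁ K₁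

/-- The product `𝔄 · 𝔅`: all `A B` with `A ∈ 𝔄(L, K)`, `B ∈ 𝔅(H, L)` for some Hilbert space `L`. -/
def OperatorFamily.mul (𝔄 𝔅 : OperatorFamily.{u}) : OperatorFamily.{u} :=
  fun H K _ _ _ _ _ _ _ _ =>
    {T | ∃ (L : Type u) (_ : NormedAddCommGroup L) (_ : InnerProductSpace ℂ L)
      (_ : CompleteSpace L) (_ : TopologicalSpace.SeparableSpace L),
      ∃ A ∈ 𝔄 L K, ∃ B ∈ 𝔅 H L, T = A ∘L B}

/-- The adjoint `𝔄*`: `𝔄*(H, K) = {A* : A ∈ 𝔄(K, H)}`. -/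
def OperatorFamily.adj (𝔄 : OperatorFamily.{u}) : OperatorFamily.{u} :=
  fun H K _ _ _ _ _ _ _ _ => {T | ∃ A ∈ 𝔄 K H, T = ContinuousLinearMap.adjoint A}

/-! ### Quasi boundary triples -/

/-- A quasi boundary triple `{G, Γ₀, Γ₁}` for `A*`, where `Γ₀`, `Γ₁` have domain `T`. The scalar
product `(x, y)`, linear in `x`, is `inner ℂ y x`. -/
structure QuasiBoundaryTriple {H : Type u} [NormedAddCommGroup H] [InnerProductSpace ℂ H]
    (A : Submodule ℂ (H × H))
    (G : Type u) [NormedAddCommGroup G] [InnerProductSpace ℂ G] where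
  T : Submodule ℂ (H × H)
  Γ₀ : T →ₗ[ℂ] G
  Γ₁ : T →ₗ[ℂ] G
  le_adjoint : T ≤ A.adjoint
  dense : A.adjoint ≤ T.topologicalClosure
  denseRange : DenseRange (fun f : T => (Γ₀ f, Γ₁ f))
  selfAdjoint_ker : LinRel.IsSelfAdjoint ((LinearMap.ker Γ₀).map T.subtype)
  green : ∀ f g : T,
    inner ℂ g.1.1 f.1.2 - inner ℂ g.1.2 f.1.1 = inner ℂ (Γ₀ g) (Γ₁ f) - inner ℂ (Γ₁ g) (Γ₀ f)

namespace QuasiBoundaryTriple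

variable {H : Type u} [NormedAddCommGroup H] [InnerProductSpace ℂ H]
  {A : Submodule ℂ (H × H)} {G : Type u} [NormedAddCommGroup G] [InnerProductSpace ℂ G]

/-- `A₀ = ker Γ₀`. -/
def A₀ (Q : QuasiBoundaryTriple A G) : Submodule ℂ (H × H) :=
  (LinearMap.ker Q.Γ₀).map Q.T.subtype

/-- `A_Θ = {f ∈ T : (Γ₀ f, Γ₁ f) ∈ Θ}` for a linear relation `Θ` in `G`. -/
def extension (Q : QuasiBoundaryTriple A G) (Θ : Submodule ℂ (G × G)) : Submodule ℂ (H × H) :=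
  (Θ.comap (Q.Γ₀.prod Q.Γ₁)).map Q.T.subtype

/-- `N̂_z(T) = {(f, z f) : (f, z f) ∈ T}`, as a subspace of `T`. -/
def defect (Q : QuasiBoundaryTriple A G) (z : ℂ) : Submodule ℂ Q.T :=
  LinearMap.ker ((LinearMap.snd ℂ H H - z • LinearMap.fst ℂ H H) ∘ₗ Q.T.subtype)

/-- The `γ`-field: (the graph of) `γ(z) = π₁ (Γ₀ ↾ N̂_z(T))⁻¹`, an operator for
`z ∈ resolventSet A₀`. -/
def gammaField (Q : QuasiBoundaryTriple A G) (z : ℂ) : Submodule ℂ (G × H) :=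
  (Q.defect z).map (Q.Γ₀.prod (LinearMap.fst ℂ H H ∘ₗ Q.T.subtype))

/-- The Weyl function: (the graph of) `M(z) = Γ₁ (Γ₀ ↾ N̂_z(T))⁻¹`, an operator for
`z ∈ resolventSet A₀`. -/
def weyl (Q : QuasiBoundaryTriple A G) (z : ℂ) : Submodule ℂ (G × G) :=
  (Q.defect z).map (Q.Γ₀.prod Q.Γ₁)

/-- If `K` is Hilbert, `X` is a separable Hilbert space and `P : K → X` is bounded and injective,
then `K` is separable. -/
theorem separableSpace_of_injective {K X : Type*} [NormedAddCommGroup K] [InnerProductSpace ℂ K]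
    [CompleteSpace K] [NormedAddCommGroup X] [InnerProductSpace ℂ X] [CompleteSpace X]
    [TopologicalSpace.SeparableSpace X] (P : K →L[ℂ] X) (hker : P.ker = ⊥) :
    TopologicalSpace.SeparableSpace K := by
  have hdense : DenseRange (ContinuousLinearMap.adjoint P) := by
    have h := ContinuousLinearMap.orthogonal_range (ContinuousLinearMap.adjoint P)
    rw [ContinuousLinearMap.adjoint_adjoint, hker] at h
    have h2 := Submodule.topologicalClosure_eq_top_iff.mpr h
    exact Submodule.dense_iff_topologicalClosure_eq_top.mpr h2
  exact hdense.separableSpace (ContinuousLinearMap.adjoint P).continuous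

/-- If `H` is separable, so is the boundary space `G` of a quasi boundary triple. -/
theorem separableSpace [CompleteSpace H] [TopologicalSpace.SeparableSpace H] [CompleteSpace G]
    (Q : QuasiBoundaryTriple A G) : TopologicalSpace.SeparableSpace G := by
  let X := WithLp 2 (H × H)
  let Y := WithLp 2 (G × G)
  have : TopologicalSpace.SeparableSpace X :=
    (WithLp.prodContinuousLinearEquiv 2 ℂ H H).symm.surjective.denseRange.separableSpace
      (WithLp.prodContinuousLinearEquiv 2 ℂ H H).symm.continuous
  let J : Q.T →ₗ[ℂ] WithLp 2 (X × Y) :=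
    (WithLp.linearEquiv 2 ℂ (X × Y)).symm.toLinearMap ∘ₗ
      (((WithLp.linearEquiv 2 ℂ (H × H)).symm.toLinearMap ∘ₗ Q.T.subtype).prod
        ((WithLp.linearEquiv 2 ℂ (G × G)).symm.toLinearMap ∘ₗ (Q.Γ₀.prod Q.Γ₁)))
  let K := (LinearMap.range J).topologicalClosure
  have : CompleteSpace K := (Submodule.isClosed_topologicalClosure _).completeSpace_coe
  let p : WithLp 2 (X × Y) →L[ℂ] X := WithLp.fstL 2 ℂ X Y
  let q : WithLp 2 (X × Y) →L[ℂ] Y := WithLp.sndL 2 ℂ X Y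
  let P : K →L[ℂ] X := p ∘L K.subtypeL
  let r : Y →L[ℂ] G := WithLp.fstL 2 ℂ G G
  -- the Green identity passes to the closure of the graph
  have key : ∀ z ∈ K, ∀ g : Q.T,
      inner ℂ g.1.1 (p z).snd - inner ℂ g.1.2 (p z).fst
        = inner ℂ (Q.Γ₀ g) (q z).snd - inner ℂ (Q.Γ₁ g) (q z).fst := by
    intro z hz g
    have hc : IsClosed {z : WithLp 2 (X × Y) |
        inner ℂ g.1.1 (p z).snd - inner ℂ g.1.2 (p z).fst
        = inner ℂ (Q.Γ₀ g) (q z).snd - inner ℂ (Q.Γ₁ g) (q z).fst} := by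
      apply isClosed_eq
      · exact (continuous_const.inner ((WithLp.sndL 2 ℂ H H ∘L p).continuous)).sub
          (continuous_const.inner ((WithLp.fstL 2 ℂ H H ∘L p).continuous))
      · exact (continuous_const.inner ((WithLp.sndL 2 ℂ G G ∘L q).continuous)).sub
          (continuous_const.inner ((WithLp.fstL 2 ℂ G G ∘L q).continuous))
    refine closure_minimal ?_ hc hz
    rintro _ ⟨f, rfl⟩
    exact Q.green f g
  have hker : P.ker = ⊥ := by
    rw [Submodule.eq_bot_iff]
    rintro ⟨z, hz⟩ h0
    have hp : p z = 0 := h0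
    have h1 : ∀ ab : G × G, inner ℂ ab.1 (q z).snd - inner ℂ ab.2 (q z).fst = 0 := by
      intro ab
      refine Q.denseRange.induction_on (p := fun ab : G × G =>
        inner ℂ ab.1 (q z).snd - inner ℂ ab.2 (q z).fst = 0) ab ?_ ?_
      · exact isClosed_eq (by fun_prop) continuous_const
      · intro g
        have := key z hz g
        rw [hp] at this
        simpa using this.symm
    have h2 : (q z).snd = 0 := by
      have := h1 ((q z).snd, 0)
      simpa using this
    have h3 : (q z).fst = 0 := by
      have := h1 (0, (q z).fst)
      simpa using this
    have hq : q z = 0 := by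
      apply WithLp.ofLp_injective 2
      exact Prod.ext h3 h2
    apply Subtype.ext
    apply WithLp.ofLp_injective 2
    exact Prod.ext hp hq
  have : TopologicalSpace.SeparableSpace K := separableSpace_of_injective P hker
  have hG : DenseRange (r ∘L q ∘L K.subtypeL) := by
    have h0 : DenseRange (fun f : Q.T => Q.Γ₀ f) :=
      (Prod.fst_surjective.denseRange).comp Q.denseRange continuous_fst
    refine h0.mono ?_
    rintro _ ⟨f, rfl⟩
    exact ⟨⟨J f, Submodule.le_topologicalClosure _ ⟨f, rfl⟩⟩, rfl⟩
  exact hG.separableSpace (r ∘L q ∘L K.subtypeL).continuous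

end QuasiBoundaryTriple

end

/-!
Green's identity is the whole argument. The boundary values `(Γ₀ f, Γ₁ f)` of
`f = (R h, h + z R h)`, `R = (S - z)⁻¹`, are determined by the pairings in Green's identity, because
`ran (Γ₀, Γ₁)` is dense; hence they depend boundedly on `h` by the closed graph theorem. Writing
`X₁` for the `Γ₀`-trace of `A_Θ₁` at `z` and `X₂` for that of `A_Θ₂* = A_Θ₂` at `conj z`, Green's
identity becomes the Krein-type formula
`(A_Θ₁ - z)⁻¹ - (A_Θ₂ - z)⁻¹ = X₂* (Θ₂ - Θ₁) X₁`, which gives the first claim.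

Tested against `f ∈ ker (T - z₀)` instead, Green's identity says that `(Θ - M(z₀)*) X` is
`γ(z₀)*` times a bounded operator, hence lies in `𝔄*`. As `Θ` is Fredholm and `M(z₀)` has compact
closure, `Θ - M(z₀)*` is invertible modulo finite rank, and finite rank operators lie in `𝔄*`; so
`X₁` and `X₂` themselves lie in `𝔄*`.
-/

noncomputable section

section Fredholm

open scoped LinearMap.FiniteRangeSetoid

variable {𝕜 E F : Type*} [RCLike 𝕜]

theorem exists_hasFiniteRange_norm_sub_le_of_isCompactOperator [NormedAddCommGroup E]
    [NormedSpace 𝕜 E] [NormedAddCommGroup F] [InnerProductSpace 𝕜 F] {K : E →L[𝕜] F}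
    (hK : IsCompactOperator K) {ε : ℝ} (hε : 0 < ε) :
    ∃ P : E →L[𝕜] F, P.HasFiniteRange ∧ ‖K - P‖ ≤ ε := by
  obtain ⟨c, hc, hKc⟩ := hK.image_closedBall_subset_compact (𝕜₁ := 𝕜) (f := K.toLinearMap) 1
  obtain ⟨net, -, hfinite, hcover⟩ := hc.finite_cover_balls hε
  let V := Submodule.span 𝕜 net
  have : FiniteDimensional 𝕜 V := .span_of_finite 𝕜 hfinite
  have hV : V.starProjection.HasFiniteRange := by
    rw [LinearMap.hasFiniteRange_iff_range, Submodule.range_starProjection]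
    exact Submodule.FG.of_finite
  refine ⟨V.starProjection ∘L K, hV.comp_right _, ?_⟩
  refine ContinuousLinearMap.opNorm_le_of_unit_norm (𝕜 := 𝕜) hε.le fun x hx => ?_
  obtain ⟨y, hy, hxy⟩ := Set.mem_iUnion₂.1 (hcover (hKc ⟨x, by simp [hx], rfl⟩))
  calc ‖K x - V.starProjection (K x)‖ = ⨅ w : V, ‖K x - w‖ := V.starProjection_minimal (K x)
    _ ≤ ‖K x - y‖ :=
      ciInf_le ⟨0, by rintro _ ⟨w, rfl⟩; exact norm_nonneg _⟩ (⟨y, Submodule.subset_span hy⟩ : V)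
    _ ≤ ε := by rw [← dist_eq_norm]; exact (Metric.mem_ball.1 hxy).le

section Banach

variable [NormedAddCommGroup E] [NormedSpace 𝕜 E] [NormedAddCommGroup F] [NormedSpace 𝕜 F]

theorem isFredholm_sub_of_hasFiniteRange {u P : E →L[𝕜] F} (hu : u.IsFredholm)
    (hP : P.HasFiniteRange) : (u - P).IsFredholm := by
  obtain ⟨v, hleft, hright⟩ := hu.exists_isQuasiInverse
  have huP : ((u - P : E →L[𝕜] F) : E →ₗ[𝕜] F) ≈ u := by
    rw [LinearMap.FiniteRangeSetoid.equiv_iff_hasFiniteRange]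
    simpa using hP.neg
  exact .of_isQuasiInverse
    ⟨Setoid.trans (LinearMap.FiniteRangeSetoid.equiv_comp_left huP) hleft,
      Setoid.trans (LinearMap.FiniteRangeSetoid.equiv_comp_right huP) hright⟩

theorem isFredholm_sub_of_norm_mul_norm_lt_one [CompleteSpace E] [CompleteSpace F]
    {u S : E →L[𝕜] F} {v : F →L[𝕜] E} (hv : v.IsQuasiInverse u) (hS : ‖S‖ * ‖v‖ < 1) :
    (u - S).IsFredholm := by
  let U := Units.oneSub (S ∘L v) ((S.opNorm_comp_le v).trans_lt hS)
  let W := Units.oneSub (v ∘L S) ((v.opNorm_comp_le S).trans_lt (by rwa [mul_comm]))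
  have hUinv : (1 - S ∘L v) ∘L (↑U⁻¹ : F →L[𝕜] F) = .id 𝕜 F := U.mul_inv
  have hWinv : (↑W⁻¹ : E →L[𝕜] E) ∘L (1 - v ∘L S) = .id 𝕜 E := W.inv_mul
  have hcomm : v ∘L (1 - S ∘L v) = (1 - v ∘L S) ∘L v := by ext; simp
  have hpush : v ∘L (↑U⁻¹ : F →L[𝕜] F) = (↑W⁻¹ : E →L[𝕜] E) ∘L v := by
    calc v ∘L (↑U⁻¹ : F →L[𝕜] F)
        = ((↑W⁻¹ : E →L[𝕜] E) ∘L (1 - v ∘L S)) ∘L v ∘L (↑U⁻¹ : F →L[𝕜] F) := by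
          rw [hWinv, ContinuousLinearMap.id_comp]
      _ = (↑W⁻¹ : E →L[𝕜] E) ∘L (v ∘L (1 - S ∘L v)) ∘L (↑U⁻¹ : F →L[𝕜] F) := by
          rw [hcomm]; rfl
      _ = (↑W⁻¹ : E →L[𝕜] E) ∘L v := by
          rw [ContinuousLinearMap.comp_assoc, hUinv, ContinuousLinearMap.comp_id]
  have hleft : (v ∘L (u - S)).toLinearMap ≈ (1 - v ∘L S).toLinearMap := by
    rw [LinearMap.FiniteRangeSetoid.equiv_iff_hasFiniteRange]
    convert LinearMap.FiniteRangeSetoid.equiv_iff_hasFiniteRange.1 hv.1 using 1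
    ext x
    simp
  have hright : ((u - S) ∘L v).toLinearMap ≈ (1 - S ∘L v).toLinearMap := by
    rw [LinearMap.FiniteRangeSetoid.equiv_iff_hasFiniteRange]
    convert LinearMap.FiniteRangeSetoid.equiv_iff_hasFiniteRange.1 hv.2 using 1
    ext x
    simp
  refine .of_isQuasiInverse (v := v ∘L (↑U⁻¹ : F →L[𝕜] F)) ⟨?_, ?_⟩
  · have h := LinearMap.FiniteRangeSetoid.equiv_comp_left
      (u' := (↑W⁻¹ : E →L[𝕜] E).toLinearMap) hleft
    rw [← ContinuousLinearMap.toLinearMap_comp, ← ContinuousLinearMap.toLinearMap_comp, hWinv] at h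
    rw [hpush]
    exact h
  · have h := LinearMap.FiniteRangeSetoid.equiv_comp_right
      (u := (↑U⁻¹ : F →L[𝕜] F).toLinearMap) hright
    rw [← ContinuousLinearMap.toLinearMap_comp, ← ContinuousLinearMap.toLinearMap_comp, hUinv] at h
    exact h

end Banach

theorem isFredholm_sub_of_isCompactOperator [NormedAddCommGroup E] [NormedSpace 𝕜 E]
    [CompleteSpace E] [NormedAddCommGroup F] [InnerProductSpace 𝕜 F] [CompleteSpace F]
    {u K : E →L[𝕜] F} (hu : u.IsFredholm) (hK : IsCompactOperator K) : (u - K).IsFredholm := by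
  obtain ⟨v, hv⟩ := hu.exists_isQuasiInverse
  obtain ⟨P, hP, hKP⟩ := exists_hasFiniteRange_norm_sub_le_of_isCompactOperator hK
    (ε := (‖v‖ + 1)⁻¹) (by positivity)
  have hsmall : ‖K - P‖ * ‖v‖ < 1 := calc
    ‖K - P‖ * ‖v‖ ≤ (‖v‖ + 1)⁻¹ * ‖v‖ := by gcongr
    _ < 1 := by rw [inv_mul_lt_one₀ (by positivity)]; linarith
  have h := isFredholm_sub_of_hasFiniteRange (isFredholm_sub_of_norm_mul_norm_lt_one hv hsmall) hP
  rwa [sub_sub, sub_add_cancel] at h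

end Fredholm

section OperatorIdeals

variable {𝔄 𝔅 : OperatorFamily.{u}}
  {H K L : Type u} [NormedAddCommGroup H] [InnerProductSpace ℂ H] [CompleteSpace H]
  [TopologicalSpace.SeparableSpace H] [NormedAddCommGroup K] [InnerProductSpace ℂ K]
  [CompleteSpace K] [TopologicalSpace.SeparableSpace K] [NormedAddCommGroup L]
  [InnerProductSpace ℂ L] [CompleteSpace L] [TopologicalSpace.SeparableSpace L]

namespace OperatorFamily

theorem mem_adj_iff {X : H →L[ℂ] K} : X ∈ 𝔄.adj H K ↔ X.adjoint ∈ 𝔄 K H := by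
  constructor
  · rintro ⟨A, hA, rfl⟩
    rwa [ContinuousLinearMap.adjoint_adjoint]
  · exact fun hX => ⟨X.adjoint, hX, X.adjoint_adjoint.symm⟩

theorem comp_mem_mul {X : L →L[ℂ] K} {Y : H →L[ℂ] L} (hX : X ∈ 𝔄 L K) (hY : Y ∈ 𝔅 H L) :
    X ∘L Y ∈ 𝔄.mul 𝔅 H K :=
  ⟨L, _, _, ‹_›, ‹_›, X, hX, Y, hY, rfl⟩

end OperatorFamily

namespace IsOperatorIdealClass

theorem comp_left (h𝔄 : IsOperatorIdealClass 𝔄) (C : K →L[ℂ] L) {X : H →L[ℂ] K}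
    (hX : X ∈ 𝔄 H K) : C ∘L X ∈ 𝔄 H L := by
  simpa using h𝔄.comp_mem (.id ℂ H) C hX

theorem comp_right (h𝔄 : IsOperatorIdealClass 𝔄) {X : K →L[ℂ] L} (hX : X ∈ 𝔄 K L)
    (B : H →L[ℂ] K) : X ∘L B ∈ 𝔄 H L := by
  simpa using h𝔄.comp_mem B (.id ℂ L) hX

theorem neg_mem (h𝔄 : IsOperatorIdealClass 𝔄) {X : H →L[ℂ] K} (hX : X ∈ 𝔄 H K) :
    -X ∈ 𝔄 H K := by
  simpa using h𝔄.comp_left (-.id ℂ K) hX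

theorem zero_mem (h𝔄 : IsOperatorIdealClass 𝔄) : (0 : H →L[ℂ] K) ∈ 𝔄 H K := by
  simpa using h𝔄.rankOne_mem (0 : H) (0 : K)

theorem sum_mem (h𝔄 : IsOperatorIdealClass 𝔄) {ι : Type*} (s : Finset ι) {X : ι → H →L[ℂ] K}
    (hX : ∀ i ∈ s, X i ∈ 𝔄 H K) : ∑ i ∈ s, X i ∈ 𝔄 H K :=
  Finset.sum_induction X (· ∈ 𝔄 H K) (fun _ _ => h𝔄.add_mem) h𝔄.zero_mem hX

theorem mem_of_hasFiniteRange (h𝔄 : IsOperatorIdealClass 𝔄) {X : H →L[ℂ] K}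
    (hX : X.HasFiniteRange) : X ∈ 𝔄 H K := by
  have : FiniteDimensional ℂ X.range := .of_fg hX.fg_range
  let b := stdOrthonormalBasis ℂ X.range
  have hproj : X = X.range.starProjection ∘L X := by
    ext x
    exact (Submodule.starProjection_eq_self_iff.2 (LinearMap.mem_range_self X.toLinearMap x)).symm
  rw [hproj, b.starProjection_eq_sum_rankOne]
  exact h𝔄.comp_right (h𝔄.sum_mem _ fun i _ => h𝔄.rankOne_mem _ _) X

theorem mem_of_comp_isFredholm_mem (h𝔄 : IsOperatorIdealClass 𝔄) {u : H →L[ℂ] K}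
    (hu : u.IsFredholm) {Y : K →L[ℂ] L} (hY : Y ∘L u ∈ 𝔄 H L) : Y ∈ 𝔄 K L := by
  obtain ⟨v, -, hv⟩ := hu.exists_isQuasiInverse
  have hfinite : (u ∘L v - .id ℂ K).HasFiniteRange :=
    LinearMap.FiniteRangeSetoid.equiv_iff_hasFiniteRange.1 hv
  have hdecomp : Y = (Y ∘L u) ∘L v + -(Y ∘L (u ∘L v - .id ℂ K)) := by
    ext x
    simp
  rw [hdecomp]
  exact h𝔄.add_mem (h𝔄.comp_right hY v)
    (h𝔄.neg_mem (h𝔄.comp_left Y (h𝔄.mem_of_hasFiniteRange hfinite)))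

end IsOperatorIdealClass

end OperatorIdeals

namespace LinRel

variable {H : Type u} [NormedAddCommGroup H] [InnerProductSpace ℂ H]
  {S : Submodule ℂ (H × H)} {z : ℂ}

theorem mem_subInv {x y : H} : (x, y) ∈ subInv S z ↔ (y, x + z • y) ∈ S := by
  rw [subInv, Submodule.mem_map]
  constructor
  · rintro ⟨⟨f, f'⟩, hf, h⟩
    obtain ⟨rfl, rfl⟩ := Prod.ext_iff.1 h
    simpa using hf
  · intro h
    exact ⟨_, h, by simp⟩

theorem eq_resolvent_iff (hz : z ∈ resolventSet S) {x y : H} :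
    y = resolvent S z x ↔ (y, x + z • y) ∈ S := by
  rw [← mem_subInv, subInv_eq_graph_resolvent hz, LinearMap.mem_graph_iff]
  rfl

theorem resolvent_mem (hz : z ∈ resolventSet S) (x : H) :
    (resolvent S z x, x + z • resolvent S z x) ∈ S :=
  (eq_resolvent_iff hz).1 rfl

variable [CompleteSpace H]

theorem subInv_adjoint (hz : z ∈ resolventSet S) :
    subInv S.adjoint (starRingEnd ℂ z) = (resolvent S z).adjoint.toLinearMap.graph := by
  ext ⟨x, y⟩
  rw [mem_subInv, LinearMap.mem_graph_iff, Submodule.mem_adjoint_iff]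
  constructor
  · intro h
    refine ext_inner_left ℂ fun k => ?_
    have hk := h _ _ (resolvent_mem hz k)
    simp only [inner_add_left, inner_add_right, inner_smul_left, inner_smul_right] at hk
    change inner ℂ k y = inner ℂ k ((resolvent S z).adjoint x)
    rw [ContinuousLinearMap.adjoint_inner_right]
    linear_combination hk
  · rintro h a b hab
    obtain rfl : y = (resolvent S z).adjoint x := h
    have ha : a = resolvent S z (b - z • a) := (eq_resolvent_iff hz).2 (by simpa using hab)
    have hax : inner ℂ a x = inner ℂ (b - z • a) ((resolvent S z).adjoint x) := by
      rw [ContinuousLinearMap.adjoint_inner_right, ← ha]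
    simp only [inner_add_right, inner_smul_right, hax, inner_sub_left, inner_smul_left]
    ring

theorem conj_mem_resolventSet_adjoint (hz : z ∈ resolventSet S) :
    starRingEnd ℂ z ∈ resolventSet S.adjoint :=
  ⟨_, subInv_adjoint hz⟩

theorem resolvent_adjoint (hz : z ∈ resolventSet S) :
    resolvent S.adjoint (starRingEnd ℂ z) = (resolvent S z).adjoint := by
  refine ContinuousLinearMap.ext fun x =>
    ((eq_resolvent_iff (conj_mem_resolventSet_adjoint hz)).2 (mem_subInv.1 ?_)).symm
  rw [subInv_adjoint hz]
  exact (LinearMap.mem_graph_iff _ _).2 rfl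

end LinRel

namespace QuasiBoundaryTriple

open LinRel

variable {H : Type u} [NormedAddCommGroup H] [InnerProductSpace ℂ H]
  {A : Submodule ℂ (H × H)} {G : Type u} [NormedAddCommGroup G] [InnerProductSpace ℂ G]
  (Q : QuasiBoundaryTriple A G)

theorem eq_of_inner_sub_inner_eq {a b : G × G}
    (h : ∀ g : Q.T, inner ℂ (Q.Γ₀ g) a.2 - inner ℂ (Q.Γ₁ g) a.1 =
      inner ℂ (Q.Γ₀ g) b.2 - inner ℂ (Q.Γ₁ g) b.1) : a = b := by
  have hall : ∀ y : G × G, inner ℂ y.1 a.2 - inner ℂ y.2 a.1 =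
      inner ℂ y.1 b.2 - inner ℂ y.2 b.1 := fun y =>
    Q.denseRange.induction_on (p := fun y : G × G => inner ℂ y.1 a.2 - inner ℂ y.2 a.1 =
      inner ℂ y.1 b.2 - inner ℂ y.2 b.1) y (isClosed_eq (by fun_prop) (by fun_prop)) h
  refine Prod.ext (ext_inner_left ℂ fun y => ?_) (ext_inner_left ℂ fun y => ?_)
  · simpa using hall (0, y)
  · simpa using hall (y, 0)

theorem mem_extension {Θ : Submodule ℂ (G × G)} {f : H × H} :
    f ∈ Q.extension Θ ↔ ∃ hf : f ∈ Q.T, (Q.Γ₀ ⟨f, hf⟩, Q.Γ₁ ⟨f, hf⟩) ∈ Θ := by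
  simp [extension]

theorem extension_le (Θ : Submodule ℂ (G × G)) : Q.extension Θ ≤ Q.T :=
  fun _ hf => (Q.mem_extension.1 hf).1

theorem mem_A₀ {f : H × H} : f ∈ Q.A₀ ↔ ∃ hf : f ∈ Q.T, Q.Γ₀ ⟨f, hf⟩ = 0 := by
  simp [A₀]

theorem mem_defect {z : ℂ} {g : Q.T} : g ∈ Q.defect z ↔ g.1.2 = z • g.1.1 := by
  simp [defect, sub_eq_zero]

theorem mem_gammaField {z : ℂ} {φ : G} {x : H} :
    (φ, x) ∈ Q.gammaField z ↔ ∃ g ∈ Q.defect z, Q.Γ₀ g = φ ∧ g.1.1 = x := by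
  simp [gammaField, Submodule.mem_map]

/-- `γ(z₀) = (1 + (z₀ - z₁) (A₀ - z₀)⁻¹) γ(z₁)`. -/
theorem mem_gammaField_of_mem_gammaField {z₀ z₁ : ℂ} (hz₀ : z₀ ∈ resolventSet Q.A₀) {φ : G} {x : H}
    (hx : (φ, x) ∈ Q.gammaField z₁) :
    (φ, x + (z₀ - z₁) • resolvent Q.A₀ z₀ x) ∈ Q.gammaField z₀ := by
  obtain ⟨g, hg, rfl, rfl⟩ := Q.mem_gammaField.1 hx
  obtain ⟨hT, hΓ₀⟩ := Q.mem_A₀.1 (resolvent_mem hz₀ g.1.1)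
  refine Q.mem_gammaField.2 ⟨g + (z₀ - z₁) • ⟨_, hT⟩, ?_, ?_, rfl⟩
  · rw [mem_defect] at hg ⊢
    simp only [Submodule.coe_add, Submodule.coe_smul, Prod.snd_add, Prod.smul_snd, Prod.fst_add,
      Prod.smul_fst, hg]
    module
  · rw [map_add, map_smul, hΓ₀, smul_zero, add_zero]

theorem mem_gammaField_adjoint_of_mem_gammaField_adjoint [CompleteSpace H] {z₀ z₁ : ℂ}
    (hz₀ : z₀ ∈ resolventSet Q.A₀) {h : H} {y : G} (hy : (h, y) ∈ (Q.gammaField z₀).adjoint) :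
    (h + starRingEnd ℂ (z₀ - z₁) • (resolvent Q.A₀ z₀).adjoint h, y) ∈
      (Q.gammaField z₁).adjoint := by
  rw [Submodule.mem_adjoint_iff] at hy ⊢
  intro φ x hx
  rw [← hy _ _ (Q.mem_gammaField_of_mem_gammaField hz₀ hx), inner_add_left, inner_add_right,
    inner_smul_left, inner_smul_right, ContinuousLinearMap.adjoint_inner_right]

section ResolventTrace

variable {S : Submodule ℂ (H × H)} (hS : S ≤ Q.T) {z : ℂ} (hz : z ∈ resolventSet S)

/-- The map `h ↦ (R h, h + z R h)`, `R = (S - z)⁻¹`, from `H` onto a restriction `S` of `T`. -/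
def resolventLift : H →ₗ[ℂ] Q.T :=
  LinearMap.codRestrict Q.T
    ((resolvent S z).prod (ContinuousLinearMap.id ℂ H + z • resolvent S z)).toLinearMap
    fun h => hS (resolvent_mem hz h)

theorem coe_resolventLift (h : H) :
    (Q.resolventLift hS hz h : H × H) = (resolvent S z h, h + z • resolvent S z h) :=
  rfl

theorem green_resolventLift (g : Q.T) (h : H) :
    inner ℂ g.1.1 (h + z • resolvent S z h) - inner ℂ g.1.2 (resolvent S z h) =
      inner ℂ (Q.Γ₀ g) (Q.Γ₁ (Q.resolventLift hS hz h)) -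
        inner ℂ (Q.Γ₁ g) (Q.Γ₀ (Q.resolventLift hS hz h)) :=
  Q.green (Q.resolventLift hS hz h) g

theorem isClosed_graph_boundary_comp_resolventLift :
    IsClosed ((Q.Γ₀.prod Q.Γ₁ ∘ₗ Q.resolventLift hS hz).graph : Set (H × (G × G))) := by
  have hgraph : ((Q.Γ₀.prod Q.Γ₁ ∘ₗ Q.resolventLift hS hz).graph : Set (H × (G × G))) =
      ⋂ g : Q.T, {p | inner ℂ g.1.1 (p.1 + z • resolvent S z p.1) -
        inner ℂ g.1.2 (resolvent S z p.1) =
          inner ℂ (Q.Γ₀ g) p.2.2 - inner ℂ (Q.Γ₁ g) p.2.1} := by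
    ext ⟨h, y⟩
    simp only [SetLike.mem_coe, LinearMap.mem_graph_iff, Set.mem_iInter, Set.mem_ofPred_eq,
      Q.green_resolventLift hS hz]
    constructor
    · rintro rfl g
      rfl
    · exact fun hy => Q.eq_of_inner_sub_inner_eq fun g => (hy g).symm
  rw [hgraph]
  exact isClosed_iInter fun g => isClosed_eq (by fun_prop) (by fun_prop)

variable [CompleteSpace H] [CompleteSpace G]

/-- The bounded operator `h ↦ (Γ₀ f, Γ₁ f)`, `f = (R h, h + z R h)`, `R = (S - z)⁻¹`, for a
restriction `S` of `T`. -/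
def resolventTrace : H →L[ℂ] G × G :=
  .ofIsClosedGraph (Q.isClosed_graph_boundary_comp_resolventLift hS hz)

/-- The `Γ₀`-component of the resolvent trace. -/
def resolventTrace₀ : H →L[ℂ] G := .fst ℂ G G ∘L Q.resolventTrace hS hz

/-- The `Γ₁`-component of the resolvent trace. -/
def resolventTrace₁ : H →L[ℂ] G := .snd ℂ G G ∘L Q.resolventTrace hS hz

theorem resolventTrace₀_apply (h : H) :
    Q.resolventTrace₀ hS hz h = Q.Γ₀ (Q.resolventLift hS hz h) :=
  rfl

theorem resolventTrace₁_apply (h : H) :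
    Q.resolventTrace₁ hS hz h = Q.Γ₁ (Q.resolventLift hS hz h) :=
  rfl

theorem resolventTrace₁_eq_comp {Θ : G →L[ℂ] G} (hΘ : S ≤ Q.extension Θ.toLinearMap.graph) :
    Q.resolventTrace₁ (hΘ.trans (Q.extension_le _)) hz =
      Θ ∘L Q.resolventTrace₀ (hΘ.trans (Q.extension_le _)) hz := by
  ext h
  exact (Q.mem_extension.1 (hΘ (resolvent_mem hz h))).2

end ResolventTrace

variable [CompleteSpace H] [CompleteSpace G] {z : ℂ}

theorem resolvent_sub_resolvent_eq_trace {S₁ S₂ : Submodule ℂ (H × H)} (hS₁ : S₁ ≤ Q.T)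
    (hS₂ : S₂.adjoint ≤ Q.T) (hz₁ : z ∈ resolventSet S₁) (hz₂ : z ∈ resolventSet S₂) :
    resolvent S₁ z - resolvent S₂ z =
      (Q.resolventTrace₁ hS₂ (conj_mem_resolventSet_adjoint hz₂)).adjoint ∘L
          Q.resolventTrace₀ hS₁ hz₁ -
        (Q.resolventTrace₀ hS₂ (conj_mem_resolventSet_adjoint hz₂)).adjoint ∘L
          Q.resolventTrace₁ hS₁ hz₁ := by
  refine ContinuousLinearMap.ext fun h => ext_inner_left ℂ fun k => ?_
  have hgreen := Q.green (Q.resolventLift hS₁ hz₁ h)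
    (Q.resolventLift hS₂ (conj_mem_resolventSet_adjoint hz₂) k)
  simp only [coe_resolventLift, resolvent_adjoint hz₂, inner_add_left, inner_add_right,
    inner_smul_left, inner_smul_right, ContinuousLinearMap.adjoint_inner_left,
    Complex.conj_conj] at hgreen
  simp only [sub_apply, ContinuousLinearMap.comp_apply, inner_sub_right,
    ContinuousLinearMap.adjoint_inner_right, resolventTrace₀_apply, resolventTrace₁_apply]
  linear_combination -hgreen

theorem resolvent_sub_resolvent {S₁ S₂ : Submodule ℂ (H × H)} {Θ₁ Θ₂ : G →L[ℂ] G}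
    (hS₁ : S₁ ≤ Q.extension Θ₁.toLinearMap.graph)
    (hS₂ : S₂.adjoint ≤ Q.extension Θ₂.adjoint.toLinearMap.graph)
    (hz₁ : z ∈ resolventSet S₁) (hz₂ : z ∈ resolventSet S₂) :
    resolvent S₁ z - resolvent S₂ z =
      (Q.resolventTrace₀ (hS₂.trans (Q.extension_le _))
          (conj_mem_resolventSet_adjoint hz₂)).adjoint ∘L
        (Θ₂ - Θ₁) ∘L Q.resolventTrace₀ (hS₁.trans (Q.extension_le _)) hz₁ := by
  rw [Q.resolvent_sub_resolvent_eq_trace (hS₁.trans (Q.extension_le _))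
      (hS₂.trans (Q.extension_le _)) hz₁ hz₂,
    Q.resolventTrace₁_eq_comp hz₁ hS₁, Q.resolventTrace₁_eq_comp _ hS₂,
    ContinuousLinearMap.adjoint_comp, ContinuousLinearMap.adjoint_adjoint]
  ext h
  simp

variable {S : Submodule ℂ (H × H)} {z₀ : ℂ} {K : G →L[ℂ] G}

theorem resolventTrace_mem_gammaField_adjoint (hK : Q.weyl z₀ ≤ K.toLinearMap.graph)
    (hS : S ≤ Q.T) (hz : z ∈ resolventSet S) (h : H) :
    (h + (z - starRingEnd ℂ z₀) • resolvent S z h,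
      Q.resolventTrace₁ hS hz h - K.adjoint (Q.resolventTrace₀ hS hz h)) ∈
      (Q.gammaField z₀).adjoint := by
  rw [Submodule.mem_adjoint_iff]
  intro φ x hx
  obtain ⟨g, hg, rfl, rfl⟩ := Q.mem_gammaField.1 hx
  have hΓ₁ : Q.Γ₁ g = K (Q.Γ₀ g) :=
    (LinearMap.mem_graph_iff _ _).1 (hK (Submodule.mem_map_of_mem hg))
  have hgreen := Q.green_resolventLift hS hz g h
  rw [Q.mem_defect.1 hg, hΓ₁, ← resolventTrace₀_apply, ← resolventTrace₁_apply] at hgreen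
  simp only [inner_add_right, inner_smul_left, inner_smul_right] at hgreen
  simp only [inner_add_right, inner_sub_right, inner_smul_right,
    ContinuousLinearMap.adjoint_inner_right]
  linear_combination hgreen

theorem exists_sub_comp_resolventTrace₀_eq (hz₀ : z₀ ∈ resolventSet Q.A₀)
    (hK : Q.weyl z₀ ≤ K.toLinearMap.graph) {z₁ : ℂ} {C : H →L[ℂ] G}
    (hC : (Q.gammaField z₁).adjoint = C.toLinearMap.graph) {Θ : G →L[ℂ] G}
    (hΘ : S ≤ Q.extension Θ.toLinearMap.graph) (hz : z ∈ resolventSet S) :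
    ∃ B : H →L[ℂ] H,
      (Θ - K.adjoint) ∘L Q.resolventTrace₀ (hΘ.trans (Q.extension_le _)) hz = C ∘L B := by
  refine ⟨(.id ℂ H + starRingEnd ℂ (z₀ - z₁) • (resolvent Q.A₀ z₀).adjoint) ∘L
    (.id ℂ H + (z - starRingEnd ℂ z₀) • resolvent S z), ?_⟩
  ext h
  have hmem := Q.mem_gammaField_adjoint_of_mem_gammaField_adjoint (z₁ := z₁) hz₀
    (Q.resolventTrace_mem_gammaField_adjoint hK (hΘ.trans (Q.extension_le _)) hz h)
  rw [hC, Q.resolventTrace₁_eq_comp hz hΘ] at hmem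
  exact (LinearMap.mem_graph_iff _ _).1 hmem

theorem resolventTrace₀_mem_adj [TopologicalSpace.SeparableSpace H]
    [TopologicalSpace.SeparableSpace G] {𝔄 : OperatorFamily.{u}} (h𝔄 : IsOperatorIdealClass 𝔄)
    (hz₀ : z₀ ∈ resolventSet Q.A₀) (hK : Q.weyl z₀ ≤ K.toLinearMap.graph) {z₁ : ℂ}
    {C : H →L[ℂ] G} (hC : (Q.gammaField z₁).adjoint = C.toLinearMap.graph) (hC𝔄 : C ∈ 𝔄.adj H G)
    {Θ : G →L[ℂ] G} (hΘ : S ≤ Q.extension Θ.toLinearMap.graph)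
    (hfred : (Θ.adjoint - K).IsFredholm) (hz : z ∈ resolventSet S) :
    Q.resolventTrace₀ (hΘ.trans (Q.extension_le _)) hz ∈ 𝔄.adj H G := by
  obtain ⟨B, hB⟩ := Q.exists_sub_comp_resolventTrace₀_eq hz₀ hK hC hΘ hz
  have hadj := congrArg ContinuousLinearMap.adjoint hB
  rw [ContinuousLinearMap.adjoint_comp, ContinuousLinearMap.adjoint_comp, map_sub,
    ContinuousLinearMap.adjoint_adjoint] at hadj
  rw [OperatorFamily.mem_adj_iff] at hC𝔄 ⊢
  refine h𝔄.mem_of_comp_isFredholm_mem hfred ?_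
  rw [hadj]
  exact h𝔄.comp_left _ hC𝔄

end QuasiBoundaryTriple

end

theorem mainTheorem10_general
    {H : Type u} [NormedAddCommGroup H] [InnerProductSpace ℂ H] [CompleteSpace H]
    [TopologicalSpace.SeparableSpace H]
    {G : Type u} [NormedAddCommGroup G] [InnerProductSpace ℂ G] [CompleteSpace G]
    {A : Submodule ℂ (H × H)} (Q : QuasiBoundaryTriple A G)
    {𝔅 : OperatorFamily.{u}} (h𝔅 : IsOperatorIdealClass 𝔅) {Θ₁ Θ₂ : G →L[ℂ] G}
    (hA₂ : (Q.extension Θ₂.toLinearMap.graph).adjoint ≤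
      Q.extension Θ₂.adjoint.toLinearMap.graph) :
    haveI : TopologicalSpace.SeparableSpace G := Q.separableSpace
    Θ₁ - Θ₂ ∈ 𝔅 G G →
    (∀ z ∈ LinRel.resolventSet (Q.extension Θ₁.toLinearMap.graph) ∩
        LinRel.resolventSet (Q.extension Θ₂.toLinearMap.graph),
      LinRel.resolvent (Q.extension Θ₁.toLinearMap.graph) z -
        LinRel.resolvent (Q.extension Θ₂.toLinearMap.graph) z ∈ 𝔅 H H) ∧
    ((∃ z₀ ∈ LinRel.resolventSet Q.A₀, ∃ K : G →L[ℂ] G, Q.weyl z₀ ≤ K.toLinearMap.graph ∧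
        (Θ₁.adjoint - K).IsFredholm ∧ (Θ₂ - K).IsFredholm) →
      ∀ 𝔄 : OperatorFamily.{u}, IsOperatorIdealClass 𝔄 →
      (∃ z₁ : ℂ, ∃ C : H →L[ℂ] G,
        (Q.gammaField z₁).adjoint = C.toLinearMap.graph ∧ C ∈ 𝔄.adj H G) →
      ∀ z ∈ LinRel.resolventSet (Q.extension Θ₁.toLinearMap.graph) ∩
          LinRel.resolventSet (Q.extension Θ₂.toLinearMap.graph),
        LinRel.resolvent (Q.extension Θ₁.toLinearMap.graph) z -
          LinRel.resolvent (Q.extension Θ₂.toLinearMap.graph) z ∈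
            ((𝔄.mul 𝔅).mul 𝔄.adj) H H) := by
  have : TopologicalSpace.SeparableSpace G := Q.separableSpace
  intro hΘ
  have hΘ' : Θ₂ - Θ₁ ∈ 𝔅 G G := by simpa only [neg_sub] using h𝔅.neg_mem hΘ
  constructor
  · rintro z ⟨hz₁, hz₂⟩
    rw [Q.resolvent_sub_resolvent le_rfl hA₂ hz₁ hz₂]
    exact h𝔅.comp_mem _ _ hΘ'
  · rintro ⟨z₀, hz₀, K, hK, hfred₁, hfred₂⟩ 𝔄 h𝔄 ⟨z₁, C, hC, hC𝔄⟩ z ⟨hz₁, hz₂⟩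
    have hX₁ := Q.resolventTrace₀_mem_adj h𝔄 hz₀ hK hC hC𝔄 le_rfl hfred₁ hz₁
    have hX₂ := Q.resolventTrace₀_mem_adj h𝔄 hz₀ hK hC hC𝔄 hA₂
      (by rwa [ContinuousLinearMap.adjoint_adjoint])
      (LinRel.conj_mem_resolventSet_adjoint hz₂)
    rw [Q.resolvent_sub_resolvent le_rfl hA₂ hz₁ hz₂, ← ContinuousLinearMap.comp_assoc]
    exact OperatorFamily.comp_mem_mul
      (OperatorFamily.comp_mem_mul (OperatorFamily.mem_adj_iff.1 hX₂) hΘ') hX₁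

theorem mainTheorem10
    {H : Type u} [NormedAddCommGroup H] [InnerProductSpace ℂ H] [CompleteSpace H]
    [TopologicalSpace.SeparableSpace H]
    {G : Type u} [NormedAddCommGroup G] [InnerProductSpace ℂ G] [CompleteSpace G]
    (A : Submodule ℂ (H × H)) (hAclosed : IsClosed (A : Set (H × H)))
    (hAsymm : LinRel.IsSymmetric A)
    (Q : QuasiBoundaryTriple A G)
    (𝔅 : OperatorFamily.{u}) (h𝔅 : IsOperatorIdealClass 𝔅)
    (Θ₁ Θ₂ : G →L[ℂ] G) (hΘ₁ : IsSelfAdjoint Θ₁) (hΘ₂ : IsSelfAdjoint Θ₂)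
    -- the closure of `M(z₀)` is a compact operator for some `z₀ ∈ ρ(A₀)`
    (hM : ∃ z₀ ∈ LinRel.resolventSet Q.A₀, ∃ K : G →L[ℂ] G,
      (Q.weyl z₀).topologicalClosure = K.toLinearMap.graph ∧ IsCompactOperator K)
    -- `0 ∉ σ_ess(Θᵢ)` and `A_Θᵢ` is self-adjoint
    (hess₁ : (0 : ℂ) ∉ essentialSpectrum Θ₁) (hess₂ : (0 : ℂ) ∉ essentialSpectrum Θ₂)
    (hA₁ : LinRel.IsSelfAdjoint (Q.extension Θ₁.toLinearMap.graph))
    (hA₂ : LinRel.IsSelfAdjoint (Q.extension Θ₂.toLinearMap.graph)) :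
    haveI : TopologicalSpace.SeparableSpace G := Q.separableSpace
    -- `Θ₁ - Θ₂ ∈ 𝔅(G)` (where `G` is separable, being the boundary space of a triple)
    Θ₁ - Θ₂ ∈ 𝔅 G G →
    (∀ z ∈ LinRel.resolventSet (Q.extension Θ₁.toLinearMap.graph) ∩
        LinRel.resolventSet (Q.extension Θ₂.toLinearMap.graph),
      LinRel.resolvent (Q.extension Θ₁.toLinearMap.graph) z -
        LinRel.resolvent (Q.extension Θ₂.toLinearMap.graph) z ∈ 𝔅 H H) ∧
    (∀ 𝔄 : OperatorFamily.{u}, IsOperatorIdealClass 𝔄 →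
      (∃ z₁ ∈ LinRel.resolventSet Q.A₀, ∃ C : H →L[ℂ] G,
        (Q.gammaField z₁).adjoint = C.toLinearMap.graph ∧ C ∈ 𝔄.adj H G) →
      ∀ z ∈ LinRel.resolventSet (Q.extension Θ₁.toLinearMap.graph) ∩
          LinRel.resolventSet (Q.extension Θ₂.toLinearMap.graph),
        LinRel.resolvent (Q.extension Θ₁.toLinearMap.graph) z -
          LinRel.resolvent (Q.extension Θ₂.toLinearMap.graph) z ∈
            ((𝔄.mul 𝔅).mul 𝔄.adj) H H) := by
  have hA₂' : (Q.extension Θ₂.toLinearMap.graph).adjoint ≤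
      Q.extension Θ₂.adjoint.toLinearMap.graph := by
    rw [hΘ₂.adjoint_eq]
    exact hA₂.ge
  have hfred {Θ K : G →L[ℂ] G} (hess : (0 : ℂ) ∉ essentialSpectrum Θ) (hK : IsCompactOperator K) :
      (Θ - K).IsFredholm :=
    isFredholm_sub_of_isCompactOperator (by simpa [essentialSpectrum] using hess) hK
  obtain ⟨z₀, hz₀, K, hK, hKc⟩ := hM
  intro hΘ
  obtain ⟨h𝔅mem, hmul⟩ := mainTheorem10_general Q h𝔅 hA₂' hΘ
  refine ⟨h𝔅mem, fun 𝔄 h𝔄 ⟨z₁, _, C, hC⟩ =>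
    hmul ⟨z₀, hz₀, K, ?_, ?_, hfred hess₂ hKc⟩ 𝔄 h𝔄 ⟨z₁, C, hC⟩⟩
  · exact hK ▸ Submodule.le_topologicalClosure _
  · exact hΘ₁.adjoint_eq.symm ▸ hfred hess₁ hKc
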